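/- A Lombardi drawing of a finite simple graph $G$ represents the vertices of $G$ by pairwise distinct points of the Euclidean plane and every edge by a line segment or a circular arc (shorter than a full circle) joining the points of its two end vertices, such that every vertex has perfect angular resolution: at each vertex $v$ of degree $d\ge 1$, the tangent rays at $v$ of the $d$ edges incident to $v$, taken in their cyclic order around $v$, form equal angles $2\pi/d$ between consecutive edges. Edges are allowed to cross each other, to overlap, and to pass through vertices, and the cyclic order of the edges around each vertex may be chosen freely. Let $G_8$ be the graph on the vertices $v_0,\dots,v_7$ in which $v_0,\dots,v_4$ are pairwise adjacent (a $K_5$), and in addition $v_5$ is adjacent to $v_3$ only, and $v_6$ and $v_7$ are each adjacent to $v_4$ only. Thus $v_0,v_1,v_2$ have degree $4$, $v_3$ has degree $5$, $v_4$ has degree $6$, and $v_5,v_6,v_7$ have degree $1$. **Theorem.** The graph $G_8$ has no Lombardi drawing, for any choice of the cyclic orderings of the edges around its vertices. -/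

import Mathlib

open Real

noncomputable section

/-- A directed straight segment or circular arc in the Euclidean plane `ℂ`. The arc runs along the
circle with centre `c` and radius `r` from the point at angle `a` to the point at angle `b`,
counterclockwise if `a < b` and clockwise if `b < a`, covering less than a full turn. -/
inductive CircArc : Type
  | segment (p q : ℂ) (hpq : p ≠ q)
  | arc (c : ℂ) (r a b : ℝ) (hr : 0 < r) (hab : a ≠ b) (hturn : |b - a| < 2 * π)

namespace CircArc

/-- The parametrization of the arc; the arc itself is traced for `t` from `0` to `1`. -/
def path : CircArc → ℝ → ℂ
  | segment p q _, t => p + (t : ℂ) * (q - p)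
  | arc c r a b _ _ _, t => circleMap c r (a + t * (b - a))

/-- The starting point. -/
def source (A : CircArc) : ℂ := A.path 0

/-- The end point. -/
def target (A : CircArc) : ℂ := A.path 1

/-- The same arc traversed in the opposite direction. -/
def reverse : CircArc → CircArc
  | segment p q h => segment q p h.symm
  | arc c r a b hr hab ht => arc c r b a hr hab.symm (by rwa [abs_sub_comm])

/-- The unit tangent vector at the starting point, pointing along the arc. -/
def startDir (A : CircArc) : ℂ := deriv A.path 0 / (‖deriv A.path 0‖ : ℂ)

theorem reverse_path (A : CircArc) (t : ℝ) : A.reverse.path t = A.path (1 - t) := by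
  cases A with
  | segment p q h => simp only [reverse, path]; push_cast; ring
  | arc c r a b hr hab ht => simp only [reverse, path]; congr 1; ring

end CircArc

/-- A drawing of `G` in the plane with distinct points for distinct vertices, in which every edge
is a single circular arc or line segment joining the points of its two end vertices.
Edges may cross, overlap, or pass through vertices. -/
structure CircArcDrawing {V : Type*} (G : SimpleGraph V) where
  pos : V → ℂ
  pos_injective : Function.Injective pos
  /-- the edge `vw`, directed from `v` to `w` -/
  edge : ∀ v w : V, G.Adj v w → CircArc
  edge_source : ∀ (v w : V) (h : G.Adj v w), (edge v w h).source = pos v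
  edge_target : ∀ (v w : V) (h : G.Adj v w), (edge v w h).target = pos w
  edge_symm : ∀ (v w : V) (h : G.Adj v w), edge w v h.symm = (edge v w h).reverse

/-- An ordering of the edges around every vertex: `ord v w` is the place of the edge `vw` in the
counterclockwise cyclic order around `v`, counted from some edge at `v`. -/
abbrev EdgeOrdering {V : Type*} (G : SimpleGraph V) [G.LocallyFinite] : Type _ :=
  ∀ v : V, G.neighborSet v ≃ Fin (G.degree v)

/-- Perfect angular resolution with the given edge ordering: at every vertex `v` the tangent
directions of the incident edges, in counterclockwise order, are spaced by `2π / deg v`,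
starting from some direction `θ`. -/
def CircArcDrawing.HasPerfectAngularResolution {V : Type*} {G : SimpleGraph V} [G.LocallyFinite]
    (D : CircArcDrawing G) (ord : EdgeOrdering G) : Prop :=
  ∀ v : V, ∃ θ : ℝ, ∀ (w : V) (h : G.Adj v w),
    (D.edge v w h).startDir =
      Complex.exp (((θ + 2 * π * ((ord v ⟨w, h⟩ : ℕ) : ℝ) / (G.degree v : ℝ) : ℝ) : ℂ) * Complex.I)

/-- `G` has a Lombardi drawing with the given ordering of the edges around the vertices. -/
def HasLombardiDrawingWith {V : Type*} (G : SimpleGraph V) [G.LocallyFinite]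
    (ord : EdgeOrdering G) : Prop :=
  ∃ D : CircArcDrawing G, D.HasPerfectAngularResolution ord

/-- `G` is a Lombardi graph: it has a Lombardi drawing for some choice of edge orderings. -/
def IsLombardi {V : Type*} (G : SimpleGraph V) [G.LocallyFinite] : Prop :=
  ∃ ord : EdgeOrdering G, HasLombardiDrawingWith G ord

/-- The complete graph on the vertices `0, …, 4`, with one degree-one vertex `5` attached to `3`
and two degree-one vertices `6, 7` attached to `4`. -/
def G8 : SimpleGraph (Fin 8) :=
  SimpleGraph.fromRel fun i j =>
    (i < 5 ∧ j < 5) ∨ (i = 3 ∧ j = 5) ∨ (i = 4 ∧ j = 6) ∨ (i = 4 ∧ j = 7)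

instance G8.decidableAdj : DecidableRel G8.Adj :=
  fun i j => decidable_of_iff _ (SimpleGraph.fromRel_adj _ i j).symm

end

/-!
A circular arc from `z` to `w` has its chord as the bisector of its end tangents: the unit start
directions of the arc and of its reverse multiply to `-(w - z) / conj (w - z)`, minus the squared
phase of the chord (`CircArc.startDir_mul_startDir_reverse`). This is the only geometric property
of arcs that is used, applied to the ten edges of the `K₅`.

The inversion at the vertex `v₃` of degree five sends `v₃` to infinity. The squared phases of the
six differences between the images of `v₀, v₁, v₂, v₄` are then determined, up to a common factor,
by the positions of the edges around the vertices: the side `jk` has the phase `yⱼ yₖ ηⱼₖ`,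
where the `yⱼ` are distinct fifth roots of unity, given by the order of the edges around `v₃`, and
the `ηⱼₖ` are twelfth roots of unity, given by the orders around the vertices of degree four and
six. The phases of the six sides of a complete quadrilateral are not independent; they satisfy the
trigonometric Ceva identity (`ceva_phaseSq`, `cevaIdentity_of_tangents`), and distinctness of the
`yⱼ` keeps the identity from being trivial.

As `ℚ(ζ₅)` and `ℚ(ζ₁₂)` are linearly disjoint, the coefficients of the Ceva identity, expanded in
powers of `ζ₅`, must all be equal (`coeff_eq_of_sum_mul_pow_eq_zero`). This leaves two cases
(`CevaIdentity.opposite_phases`): the three products of `ηⱼₖ` over opposite sides agree, or the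
`ηⱼₖ` of two opposite sides agree for two of the three pairs of opposite sides. In each case,
fourth powers, which remove the contributions of the vertices of degree four, give a relation
between sixth roots of unity at `v₄` that contradicts the distinctness of the edge directions
there (`opposite_phases_contradiction`).
-/

open scoped ComplexConjugate

/-! ### Squared phases -/

/-- The squared phase `z / z̄ = e^{2i arg z}` of a complex number. -/
noncomputable def phaseSq (z : ℂ) : ℂ := z / conj z

theorem phaseSq_neg (z : ℂ) : phaseSq (-z) = phaseSq z := by
  simp [phaseSq, neg_div_neg_eq]

theorem phaseSq_div (z w : ℂ) : phaseSq (z / w) = phaseSq z / phaseSq w := by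
  simp only [phaseSq, map_div₀]
  rw [div_div_div_comm]

theorem phaseSq_mul (z w : ℂ) : phaseSq (z * w) = phaseSq z * phaseSq w := by
  simp only [phaseSq, map_mul]
  rw [mul_div_mul_comm]

/-! ### Tangent directions of circular arcs -/

namespace CircArc

theorem source_segment (p q : ℂ) (h : p ≠ q) : (segment p q h).source = p := by
  simp [source, path]

theorem target_segment (p q : ℂ) (h : p ≠ q) : (segment p q h).target = q := by
  simp [target, path]

theorem source_arc (c : ℂ) (r a b : ℝ) (hr hab ht) :
    (arc c r a b hr hab ht).source = c + r * Complex.exp (a * Complex.I) := by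
  simp [source, path, circleMap]

theorem target_arc (c : ℂ) (r a b : ℝ) (hr hab ht) :
    (arc c r a b hr hab ht).target = c + r * Complex.exp (b * Complex.I) := by
  simp [target, path, circleMap]

theorem startDir_segment (p q : ℂ) (h : p ≠ q) :
    (segment p q h).startDir = (q - p) / ‖q - p‖ := by
  have : HasDerivAt (segment p q h).path (q - p) 0 := by
    have h1 : HasDerivAt (fun t : ℝ => (t : ℂ)) 1 0 := Complex.ofRealCLM.hasDerivAt
    have h2 := (h1.mul_const (q - p)).const_add p
    rw [one_mul] at h2
    exact h2
  rw [startDir, this.deriv]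

theorem startDir_arc (c : ℂ) (r a b : ℝ) (hr hab ht) :
    (arc c r a b hr hab ht).startDir =
      ((b - a : ℝ) / |b - a| : ℝ) * (Complex.exp (a * Complex.I) * Complex.I) := by
  have hd : HasDerivAt (arc c r a b hr hab ht).path
      (((b - a : ℝ) : ℂ) * (r * Complex.exp (a * Complex.I) * Complex.I)) 0 := by
    have h1 : HasDerivAt (fun t : ℝ => a + t * (b - a)) (b - a) 0 := by
      simpa using ((hasDerivAt_id (0 : ℝ)).mul_const (b - a)).const_add a
    have h2 := hasDerivAt_circleMap c r (a + 0 * (b - a))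
    have h3 := HasDerivAt.scomp (0 : ℝ) h2 h1
    have e : (arc c r a b hr hab ht).path = circleMap c r ∘ fun t : ℝ => a + t * (b - a) := rfl
    rw [e]
    simpa [circleMap] using h3
  have hr' : (r : ℂ) ≠ 0 := by exact_mod_cast hr.ne'
  rw [startDir, hd.deriv]
  simp only [norm_mul, Complex.norm_real, Complex.norm_I, Complex.norm_exp_ofReal_mul_I,
    Real.norm_eq_abs, abs_of_pos hr, mul_one]
  push_cast
  rw [show ((b : ℂ) - a) * (r * Complex.exp (a * Complex.I) * Complex.I) =
    (r : ℂ) * (((b : ℂ) - a) * (Complex.exp (a * Complex.I) * Complex.I)) by ring,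
    mul_comm _ (r : ℂ), mul_div_mul_left _ _ hr', mul_div_right_comm]

/-- The chord bisects the angle between the two end tangents of a circular arc: the two
outward tangent directions multiply to minus the squared phase of the chord. -/
theorem startDir_mul_startDir_reverse (A : CircArc) (h : A.source ≠ A.target) :
    A.startDir * A.reverse.startDir = -phaseSq (A.target - A.source) := by
  cases A with
  | segment p q hpq =>
    have hq : q - p ≠ 0 := sub_ne_zero.2 hpq.symm
    have hn : (‖q - p‖ : ℂ) ≠ 0 := by simpa using hq
    have hc : conj (q - p) ≠ 0 := (map_ne_zero _).2 hq
    have key : (‖q - p‖ : ℂ) * ‖q - p‖ = (q - p) * conj (q - p) := by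
      rw [Complex.mul_conj, Complex.normSq_eq_norm_sq]; push_cast; ring
    rw [reverse, startDir_segment, startDir_segment, source_segment, target_segment, phaseSq,
      norm_sub_rev p q, div_mul_div_comm, key, ← neg_sub q p, mul_neg, neg_div,
      mul_div_mul_left _ _ hq]
  | arc c r a b hr hab ht =>
    rw [source_arc, target_arc] at h
    rw [reverse, startDir_arc, startDir_arc, source_arc, target_arc, phaseSq]
    have hr' : (r : ℂ) ≠ 0 := by exact_mod_cast hr.ne'
    have hs : ((b - a : ℝ) / |b - a| : ℝ) * ((a - b : ℝ) / |a - b| : ℝ) = -1 := by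
      have h0 : b - a ≠ 0 := sub_ne_zero.2 hab.symm
      rw [abs_sub_comm a b, div_mul_div_comm, abs_mul_abs_self]
      field_simp
      ring
    have hs' : (((b - a : ℝ) / |b - a| : ℝ) : ℂ) * (((a - b : ℝ) / |a - b| : ℝ) : ℂ) = -1 := by
      exact_mod_cast hs
    have hA : Complex.exp (a * Complex.I) ≠ 0 := Complex.exp_ne_zero _
    have hB : Complex.exp (b * Complex.I) ≠ 0 := Complex.exp_ne_zero _
    have hconj : ∀ x : ℝ, conj (Complex.exp (x * Complex.I)) =
        (Complex.exp (x * Complex.I))⁻¹ := by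
      intro x
      rw [← Complex.exp_conj, ← Complex.exp_neg]
      simp
    have hne : Complex.exp (b * Complex.I) - Complex.exp (a * Complex.I) ≠ 0 := by
      intro h0
      exact h (by rw [sub_eq_zero.1 h0])
    simp only [map_sub, map_add, map_mul, hconj, Complex.conj_ofReal]
    generalize Complex.exp (a * Complex.I) = α at *
    generalize Complex.exp (b * Complex.I) = β at *
    have hne' : α - β ≠ 0 := by
      rw [← neg_sub]; exact neg_ne_zero.2 hne
    have e1 : conj c + r * β⁻¹ - (conj c + r * α⁻¹) = r * (α - β) / (α * β) := by
      field_simp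
      ring
    have e2 : c + r * β - (c + r * α) = -(r * (α - β)) := by ring
    rw [e1, e2, neg_div, neg_neg, div_div_cancel₀ (mul_ne_zero hr' hne'),
      mul_mul_mul_comm, hs']
    linear_combination (-(α * β)) * Complex.I_mul_I

end CircArc

/-! ### Tangent directions in a drawing with perfect angular resolution -/

namespace CircArcDrawing

variable {V : Type*} {G : SimpleGraph V}

theorem startDir_ne_zero_of_resolution [G.LocallyFinite] {D : CircArcDrawing G}
    {ord : EdgeOrdering G} (hD : D.HasPerfectAngularResolution ord) {v w : V} (h : G.Adj v w) :
    (D.edge v w h).startDir ≠ 0 := by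
  obtain ⟨θ, hθ⟩ := hD v
  rw [hθ w h]
  exact Complex.exp_ne_zero _

theorem startDir_mul_startDir_symm (D : CircArcDrawing G) {v w : V} (h : G.Adj v w) :
    (D.edge v w h).startDir * (D.edge w v h.symm).startDir = -phaseSq (D.pos w - D.pos v) := by
  have := (D.edge v w h).startDir_mul_startDir_reverse (by
    rw [D.edge_source, D.edge_target]
    exact fun e => h.ne (D.pos_injective e))
  rwa [D.edge_source, D.edge_target, ← D.edge_symm] at this

theorem exists_startDir_eq_mul_pow [G.LocallyFinite] {D : CircArcDrawing G}
    {ord : EdgeOrdering G} (hD : D.HasPerfectAngularResolution ord) (v : V) :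
    ∃ κ : ℂ, κ ≠ 0 ∧ ∀ (w : V) (h : G.Adj v w), (D.edge v w h).startDir =
      κ * Complex.exp (2 * π * Complex.I / G.degree v) ^ (ord v ⟨w, h⟩ : ℕ) := by
  obtain ⟨θ, hθ⟩ := hD v
  refine ⟨Complex.exp (θ * Complex.I), Complex.exp_ne_zero _, fun w h => ?_⟩
  rw [hθ w h, ← Complex.exp_nat_mul, ← Complex.exp_add]
  congr 1
  push_cast
  ring

/-- The ratio of two tangent directions at a vertex of degree `d` is a `d`-th root of unity. -/
theorem startDir_div_startDir_pow [G.LocallyFinite] {D : CircArcDrawing G}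
    {ord : EdgeOrdering G} (hD : D.HasPerfectAngularResolution ord) {v w x : V} {d : ℕ}
    (hd : G.degree v = d) (hw : G.Adj v w) (hx : G.Adj v x) :
    ((D.edge v w hw).startDir / (D.edge v x hx).startDir) ^ d = 1 := by
  obtain ⟨κ, hκ, h⟩ := exists_startDir_eq_mul_pow hD v
  have h0 : G.degree v ≠ 0 := fun h0 => (h0 ▸ ord v ⟨w, hw⟩).elim0
  have hζ := (Complex.isPrimitiveRoot_exp _ h0).pow_eq_one
  subst hd
  rw [h, h, mul_div_mul_left _ _ hκ, div_pow, pow_right_comm, hζ, pow_right_comm, hζ]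
  simp

theorem eq_of_startDir_eq [G.LocallyFinite] {D : CircArcDrawing G}
    {ord : EdgeOrdering G} (hD : D.HasPerfectAngularResolution ord) {v w x : V}
    (hw : G.Adj v w) (hx : G.Adj v x)
    (he : (D.edge v w hw).startDir = (D.edge v x hx).startDir) : w = x := by
  obtain ⟨κ, hκ, h⟩ := exists_startDir_eq_mul_pow hD v
  have h0 : G.degree v ≠ 0 := fun h0 => (h0 ▸ ord v ⟨w, hw⟩).elim0
  rw [h, h] at he
  have := (Complex.isPrimitiveRoot_exp _ h0).pow_inj (Fin.isLt _) (Fin.isLt _)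
    (mul_left_cancel₀ hκ he)
  exact congrArg Subtype.val ((ord v).injective (Fin.ext this))

end CircArcDrawing

/-! ### Linear relations between fifth roots of unity over the twelfth roots -/

theorem isPrimitiveRoot_mul_of_coprime {M : Type*} [CommMonoid M] {ω ξ : M} {m n : ℕ}
    (hω : IsPrimitiveRoot ω m) (hξ : IsPrimitiveRoot ξ n) (hmn : m.Coprime n) :
    IsPrimitiveRoot (ω * ξ) (m * n) := by
  rw [hω.eq_orderOf, hξ.eq_orderOf] at hmn ⊢
  rw [← (Commute.all ω ξ).orderOf_mul_eq_mul_orderOf_of_coprime hmn]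
  exact IsPrimitiveRoot.orderOf _

open Polynomial in
/-- A polynomial relation over `ℤ[ω]`, `ω` a primitive twelfth root of unity, that holds at one
primitive fifth root of unity holds at its powers too: the Galois conjugation of the sixtieth
roots of unity can be chosen to fix `ω`. -/
theorem sum_mul_pow_eq_zero_of_conj {ω ξ : ℂ} (hω : IsPrimitiveRoot ω 12)
    (hξ : IsPrimitiveRoot ξ 5) {c : ℕ → ℂ} (hc : ∀ i, c i ∈ Algebra.adjoin ℤ {ω})
    (h : ∑ i ∈ Finset.range 5, c i * ξ ^ i = 0) {k : ℕ} (hk : k.Coprime 5) :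
    ∑ i ∈ Finset.range 5, c i * (ξ ^ k) ^ i = 0 := by
  simp only [Algebra.adjoin_singleton_eq_range_aeval, AlgHom.mem_range] at hc
  choose P hP using hc
  -- `ζ` is a sixtieth root of unity with `ζ ^ 5 = ω` and `ζ ^ 12 = ξ`
  set ζ : ℂ := ω ^ 5 * ξ ^ 3 with hζ
  have hζ' : IsPrimitiveRoot ζ 60 :=
    isPrimitiveRoot_mul_of_coprime (hω.pow_of_coprime 5 (by norm_num))
      (hξ.pow_of_coprime 3 (by norm_num)) (by norm_num)
  have h5 : ζ ^ 5 = ω := by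
    have e1 := hω.pow_eq_one
    have e2 := hξ.pow_eq_one
    calc ζ ^ 5 = (ω ^ 12) ^ 2 * ω * (ξ ^ 5) ^ 3 := by rw [hζ]; ring
      _ = ω := by rw [e1, e2]; ring
  have h12 : ζ ^ 12 = ξ := by
    have e1 := hω.pow_eq_one
    have e2 := hξ.pow_eq_one
    calc ζ ^ 12 = (ω ^ 12) ^ 5 * ξ * (ξ ^ 5) ^ 7 := by rw [hζ]; ring
      _ = ξ := by rw [e1, e2]; ring
  obtain ⟨l, hl12, hl5⟩ := Nat.chineseRemainder (show Nat.Coprime 12 5 by norm_num) 1 k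
  have hl : l.Coprime 60 := by
    rw [show 60 = 12 * 5 by norm_num]
    refine Nat.Coprime.mul_right ?_ ?_
    · rw [Nat.Coprime, hl12.gcd_eq]; norm_num
    · rw [Nat.Coprime, hl5.gcd_eq]; exact hk
  have hω' : ω ^ l = ω := by
    rw [← pow_mod_orderOf, ← hω.eq_orderOf, hl12]; simp
  have hξ' : ξ ^ l = ξ ^ k := by
    rw [← pow_mod_orderOf, ← hξ.eq_orderOf, hl5, hξ.eq_orderOf, pow_mod_orderOf]
  set F : ℤ[X] := ∑ i ∈ Finset.range 5, (P i).comp (X ^ 5) * (X ^ 12) ^ i with hF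
  have hev : ∀ x : ℂ, aeval x F =
      ∑ i ∈ Finset.range 5, aeval (x ^ 5) (P i) * (x ^ 12) ^ i := by
    intro x
    simp [hF, aeval_comp]
  have h0 : aeval ζ F = 0 := by
    rw [hev, h5, h12, ← h]
    simp [hP]
  have hdvd : minpoly ℤ ζ ∣ F :=
    minpoly.isIntegrallyClosed_dvd (hζ'.isIntegral (by norm_num)) h0
  rw [hζ'.minpoly_eq_pow_coprime hl] at hdvd
  have h1 : aeval (ζ ^ l) F = 0 := by
    obtain ⟨Q, hQ⟩ := hdvd
    rw [hQ, map_mul, minpoly.aeval, zero_mul]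
  rw [hev, pow_right_comm, h5, hω', pow_right_comm ζ l 12, h12, hξ'] at h1
  simpa [hP] using h1

open Polynomial in
/-- The only linear relations over `ℤ[ω]` between `1, ξ, ξ², ξ³, ξ⁴` are the multiples of
`1 + ξ + ξ² + ξ³ + ξ⁴ = 0`. -/
theorem coeff_eq_of_sum_mul_pow_eq_zero {ω ξ : ℂ} (hω : IsPrimitiveRoot ω 12)
    (hξ : IsPrimitiveRoot ξ 5) {c : ℕ → ℂ} (hc : ∀ i, c i ∈ Algebra.adjoin ℤ {ω})
    (h : ∑ i ∈ Finset.range 5, c i * ξ ^ i = 0) {i : ℕ} (hi : i < 5) : c i = c 4 := by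
  set p : ℂ[X] := ∑ i ∈ Finset.range 4, C (c i - c 4) * X ^ i with hp
  -- subtracting `c 4` times the cyclotomic relation leaves a cubic with four roots
  have hdeg : p.natDegree < 4 := by
    refine (natDegree_sum_le_of_forall_le (n := 3) _ _ fun i hi => ?_).trans_lt (by norm_num)
    refine (natDegree_C_mul_X_pow_le _ _).trans ?_
    have := Finset.mem_range.1 hi
    omega
  have hroot : ∀ j : Fin 4, p.eval (ξ ^ (j.1 + 1)) = 0 := by
    intro j
    have hco : (j.1 + 1).Coprime 5 := by fin_cases j <;> norm_num
    have h1 := sum_mul_pow_eq_zero_of_conj hω hξ hc h hco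
    have h2 := (hξ.pow_of_coprime _ hco).geom_sum_eq_zero (by norm_num)
    simp only [hp, eval_finsetSum, eval_mul, eval_C, eval_pow, eval_X]
    simp only [Finset.sum_range_succ, Finset.sum_range_zero] at h1 h2 ⊢
    linear_combination h1 - c 4 * h2
  have hinj : Function.Injective fun j : Fin 4 => ξ ^ (j.1 + 1) := by
    intro a b hab
    have := hξ.pow_inj (by omega) (by omega) hab
    exact Fin.ext (by omega)
  have hp0 : p = 0 := eq_zero_of_natDegree_lt_card_of_eval_eq_zero p hinj hroot
    (by simpa using hdeg)
  obtain rfl | hi4 := eq_or_ne i 4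
  · rfl
  have := congrArg (fun q => q.coeff i) hp0
  simp only [hp, finsetSum_coeff, coeff_C_mul, coeff_X_pow, coeff_zero, mul_ite, mul_one, mul_zero,
    Finset.sum_ite_eq, Finset.mem_range] at this
  rw [if_pos (by omega)] at this
  exact sub_eq_zero.1 this

/-! ### The Ceva identity for phases -/

/-- Trigonometric Ceva theorem for a triangle `w₀w₁w₂` and a point `w₄`: a difference of two
squared phases at a vertex is, up to a phase, twice the sine of the angle between the sides.
Multiplied by the conjugates of the sides, both products become the same product of three signed
triangle areas. -/
theorem ceva_phaseSq {w₀ w₁ w₂ w₄ : ℂ} (h01 : w₁ - w₀ ≠ 0) (h02 : w₂ - w₀ ≠ 0)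
    (h12 : w₂ - w₁ ≠ 0) (h04 : w₄ - w₀ ≠ 0) (h14 : w₄ - w₁ ≠ 0) (h24 : w₄ - w₂ ≠ 0) :
    (phaseSq (w₄ - w₀) - phaseSq (w₁ - w₀)) * (phaseSq (w₄ - w₁) - phaseSq (w₂ - w₁)) *
        (phaseSq (w₄ - w₂) - phaseSq (w₂ - w₀)) =
      (phaseSq (w₄ - w₀) - phaseSq (w₂ - w₀)) * (phaseSq (w₄ - w₁) - phaseSq (w₁ - w₀)) *
        (phaseSq (w₄ - w₂) - phaseSq (w₂ - w₁)) := by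
  have hc : ∀ {x y : ℂ}, x - y ≠ 0 → conj x - conj y ≠ 0 := fun {x y} h => by
    rw [← map_sub]; exact (map_ne_zero _).2 h
  have c01 := hc h01
  have c02 := hc h02
  have c12 := hc h12
  have c04 := hc h04
  have c14 := hc h14
  have c24 := hc h24
  simp only [phaseSq, map_sub]
  field_simp
  ring

/-- The trigonometric Ceva identity for four points `w₀, w₁, w₂, w₄` whose six differences have
squared phases `y₀A, y₁B, y₂C` (sides `04, 14, 24`) and `y₀y₁a, y₁y₂b, y₀y₂c` (sides
`01, 12, 02`) up to a common factor; the nonzero common factors of the two sides of the identity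
are cancelled. The pairs of opposite sides are `(A, b)`, `(B, c)`, `(C, a)`. -/
def CevaIdentity (A B C a b c y₀ y₁ y₂ : ℂ) : Prop :=
  (A - a * y₁) * (B - b * y₂) * (C - c * y₀) = (A - c * y₂) * (B - a * y₀) * (C - b * y₁)

theorem CevaIdentity.rotate {A B C a b c y₀ y₁ y₂ : ℂ} (h : CevaIdentity A B C a b c y₀ y₁ y₂) :
    CevaIdentity B C A b c a y₁ y₂ y₀ := by
  unfold CevaIdentity at *
  linear_combination h

theorem CevaIdentity.swap {A B C a b c y₀ y₁ y₂ : ℂ} (h : CevaIdentity A B C a b c y₀ y₁ y₂) :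
    CevaIdentity B A C a c b y₁ y₀ y₂ := by
  unfold CevaIdentity at *
  linear_combination -h

/-- Expanding the Ceva identity in powers of `ξ` gives five coefficients in `ℤ[ω]`, which must all
be equal. -/
theorem CevaIdentity.coeff_relations {ω ξ : ℂ} (hω : IsPrimitiveRoot ω 12)
    (hξ : IsPrimitiveRoot ξ 5) {A B C a b c : ℂ}
    (hA : A ∈ Algebra.adjoin ℤ {ω}) (hB : B ∈ Algebra.adjoin ℤ {ω})
    (hC : C ∈ Algebra.adjoin ℤ {ω}) (ha : a ∈ Algebra.adjoin ℤ {ω})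
    (hb : b ∈ Algebra.adjoin ℤ {ω}) (hc : c ∈ Algebra.adjoin ℤ {ω})
    (hb0 : b ≠ 0) (hc0 : c ≠ 0)
    (h : CevaIdentity A B C a b c ξ (ξ ^ 2) (ξ ^ 3)) :
    (a * C = c * B ∧ c * B = b * A) ∨ (A = b ∧ B = c) := by
  let U := a * C - c * B
  let V := b * A - a * C
  let W := c * B - b * A
  have hU : U ∈ Algebra.adjoin ℤ {ω} := sub_mem (mul_mem ha hC) (mul_mem hc hB)
  have hV : V ∈ Algebra.adjoin ℤ {ω} := sub_mem (mul_mem hb hA) (mul_mem ha hC)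
  have hW : W ∈ Algebra.adjoin ℤ {ω} := sub_mem (mul_mem hc hB) (mul_mem hb hA)
  -- `d i` is the coefficient of `ξ ^ i` in the difference of the two sides, as `ξ ^ 5 = 1`
  let d : ℕ → ℂ := fun i => match i with
    | 0 => b * U
    | 1 => A * U
    | 2 => B * V
    | 3 => (C + a) * W
    | _ => c * V
  have hd : ∀ i, d i ∈ Algebra.adjoin ℤ {ω} := by
    intro i
    match i with
    | 0 => exact mul_mem hb hU
    | 1 => exact mul_mem hA hU
    | 2 => exact mul_mem hB hV
    | 3 => exact mul_mem (add_mem hC ha) hW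
    | _ + 4 => exact mul_mem hc hV
  have h5 := hξ.pow_eq_one
  have hsum : ∑ i ∈ Finset.range 5, d i * ξ ^ i = 0 := by
    simp only [Finset.sum_range_succ, Finset.sum_range_zero, d, U, V, W]
    unfold CevaIdentity at h
    linear_combination h - b * (a * C - c * B) * h5
  have key := fun {i : ℕ} => coeff_eq_of_sum_mul_pow_eq_zero hω hξ hd hsum (i := i)
  have e0 : b * U = c * V := key (i := 0) (by norm_num)
  have e1 : A * U = c * V := key (i := 1) (by norm_num)
  have e2 : B * V = c * V := key (i := 2) (by norm_num)
  by_cases hV0 : V = 0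
  · left
    rw [hV0, mul_zero] at e0
    have hU0 : U = 0 := (mul_eq_zero.1 e0).resolve_left hb0
    have hU1 : a * C = c * B := sub_eq_zero.1 hU0
    have hV1 : b * A = a * C := sub_eq_zero.1 hV0
    exact ⟨hU1, hU1.symm.trans hV1.symm⟩
  · right
    have hU0 : U ≠ 0 := by
      intro h0
      rw [h0, mul_zero] at e1
      exact (mul_ne_zero hc0 hV0) e1.symm
    exact ⟨mul_right_cancel₀ hU0 (e1.trans e0.symm), mul_right_cancel₀ hV0 e2⟩

/-- Three distinct nontrivial fifth roots of unity are `ξ, ξ², ξ³` in some order, for a suitable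
primitive fifth root of unity `ξ`: the inverse of the missing one. -/
theorem exists_eq_pow_of_three_fifth_roots {y₀ y₁ y₂ : ℂ} (h0 : y₀ ^ 5 = 1) (h1 : y₁ ^ 5 = 1)
    (h2 : y₂ ^ 5 = 1) (n0 : y₀ ≠ 1) (n1 : y₁ ≠ 1) (n2 : y₂ ≠ 1) (n01 : y₀ ≠ y₁) (n02 : y₀ ≠ y₂)
    (n12 : y₁ ≠ y₂) :
    ∃ ξ : ℂ, IsPrimitiveRoot ξ 5 ∧
      ((y₀ = ξ ∧ y₁ = ξ ^ 2 ∧ y₂ = ξ ^ 3) ∨ (y₁ = ξ ∧ y₂ = ξ ^ 2 ∧ y₀ = ξ ^ 3) ∨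
       (y₂ = ξ ∧ y₀ = ξ ^ 2 ∧ y₁ = ξ ^ 3) ∨ (y₁ = ξ ∧ y₀ = ξ ^ 2 ∧ y₂ = ξ ^ 3) ∨
       (y₀ = ξ ∧ y₂ = ξ ^ 2 ∧ y₁ = ξ ^ 3) ∨ (y₂ = ξ ∧ y₁ = ξ ^ 2 ∧ y₀ = ξ ^ 3)) := by
  have hζ := Complex.isPrimitiveRoot_exp 5 (by norm_num)
  generalize Complex.exp (2 * π * Complex.I / (5 : ℕ)) = ζ at hζ
  obtain ⟨i, hi, rfl⟩ := hζ.eq_pow_of_pow_eq_one h0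
  obtain ⟨j, hj, rfl⟩ := hζ.eq_pow_of_pow_eq_one h1
  obtain ⟨k, hk, rfl⟩ := hζ.eq_pow_of_pow_eq_one h2
  have exponents : ∀ i j k : Fin 5, i ≠ 0 → j ≠ 0 → k ≠ 0 → i ≠ j → i ≠ k → j ≠ k →
      ∃ t : Fin 5, t ≠ 0 ∧
      ((i = t ∧ j = t * 2 ∧ k = t * 3) ∨ (j = t ∧ k = t * 2 ∧ i = t * 3) ∨
       (k = t ∧ i = t * 2 ∧ j = t * 3) ∨ (j = t ∧ i = t * 2 ∧ k = t * 3) ∨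
       (i = t ∧ k = t * 2 ∧ j = t * 3) ∨ (k = t ∧ j = t * 2 ∧ i = t * 3)) := by
    decide
  have red : ∀ t s : Fin 5, ζ ^ (t * s : Fin 5).val = (ζ ^ t.val) ^ s.val := by
    intro t s
    have := pow_mod_orderOf ζ (t.val * s.val)
    rw [← hζ.eq_orderOf] at this
    rw [← pow_mul, Fin.val_mul, this]
  lift i to Fin 5 using hi
  lift j to Fin 5 using hj
  lift k to Fin 5 using hk
  obtain ⟨t, ht, h⟩ := exponents i j k (by rintro rfl; simp at n0) (by rintro rfl; simp at n1)
    (by rintro rfl; simp at n2) (by rintro rfl; exact n01 rfl) (by rintro rfl; exact n02 rfl)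
    (by rintro rfl; exact n12 rfl)
  have htc : t.val.Coprime 5 :=
    (Nat.coprime_of_lt_prime (Fin.val_ne_zero_iff.2 ht) t.isLt Nat.prime_five).symm
  refine ⟨ζ ^ t.val, hζ.pow_of_coprime _ htc, ?_⟩
  have r2 : ζ ^ (t * 2 : Fin 5).val = (ζ ^ t.val) ^ 2 := red t 2
  have r3 : ζ ^ (t * 3 : Fin 5).val = (ζ ^ t.val) ^ 3 := red t 3
  rw [← r2, ← r3]
  rcases h with ⟨rfl, rfl, rfl⟩ | ⟨rfl, rfl, rfl⟩ | ⟨rfl, rfl, rfl⟩ | ⟨rfl, rfl, rfl⟩ |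
    ⟨rfl, rfl, rfl⟩ | ⟨rfl, rfl, rfl⟩ <;> simp

/-- Consequence of the independence of fifth and twelfth roots of unity: either the three
products of opposite phases agree, or in two of the three pairs of opposite sides the phases
agree. -/
theorem CevaIdentity.opposite_phases {A B C a b c y₀ y₁ y₂ : ℂ}
    (h : CevaIdentity A B C a b c y₀ y₁ y₂)
    (hA : A ^ 12 = 1) (hB : B ^ 12 = 1) (hC : C ^ 12 = 1)
    (ha : a ^ 12 = 1) (hb : b ^ 12 = 1) (hc : c ^ 12 = 1)
    (h0 : y₀ ^ 5 = 1) (h1 : y₁ ^ 5 = 1) (h2 : y₂ ^ 5 = 1) (n0 : y₀ ≠ 1) (n1 : y₁ ≠ 1)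
    (n2 : y₂ ≠ 1) (n01 : y₀ ≠ y₁) (n02 : y₀ ≠ y₂) (n12 : y₁ ≠ y₂) :
    (a * C = c * B ∧ c * B = b * A) ∨ (A = b ∧ B = c) ∨ (B = c ∧ C = a) ∨ (C = a ∧ A = b) := by
  have hω := Complex.isPrimitiveRoot_exp 12 (by norm_num)
  generalize Complex.exp (2 * π * Complex.I / (12 : ℕ)) = ω at hω
  have mem : ∀ {x : ℂ}, x ^ 12 = 1 → x ∈ Algebra.adjoin ℤ {ω} := by
    intro x hx
    obtain ⟨i, -, rfl⟩ := hω.eq_pow_of_pow_eq_one hx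
    exact pow_mem (Algebra.self_mem_adjoin_singleton ℤ ω) i
  have ne : ∀ {x : ℂ}, x ^ 12 = 1 → x ≠ 0 := by
    rintro x hx rfl
    norm_num at hx
  have mA := mem hA
  have mB := mem hB
  have mC := mem hC
  have ma := mem ha
  have mb := mem hb
  have mc := mem hc
  obtain ⟨ξ, hξ, h'⟩ := exists_eq_pow_of_three_fifth_roots h0 h1 h2 n0 n1 n2 n01 n02 n12
  rcases h' with ⟨rfl, rfl, rfl⟩ | ⟨rfl, rfl, rfl⟩ | ⟨rfl, rfl, rfl⟩ | ⟨rfl, rfl, rfl⟩ |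
    ⟨rfl, rfl, rfl⟩ | ⟨rfl, rfl, rfl⟩
  · have := h.coeff_relations hω hξ mA mB mC ma mb mc (ne hb) (ne hc)
    grind
  · have := h.rotate.coeff_relations hω hξ mB mC mA mb mc ma (ne hc) (ne ha)
    grind
  · have := h.rotate.rotate.coeff_relations hω hξ mC mA mB mc ma mb (ne ha) (ne hb)
    grind
  · have := h.swap.coeff_relations hω hξ mB mA mC ma mc mb (ne hc) (ne hb)
    grind
  · have := h.swap.rotate.coeff_relations hω hξ mA mC mB mc mb ma (ne hb) (ne ha)
    grind
  · have := h.swap.rotate.rotate.coeff_relations hω hξ mC mB mA mb ma mc (ne ha) (ne hc)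
    grind

/-- Inversion at `z₃` sends `z₃` to infinity; the phases of the differences of the images are
given by the phases of the original differences. -/
theorem phaseSq_inv_sub_inv {z₃ x y : ℂ} (hx : x - z₃ ≠ 0) (hy : y - z₃ ≠ 0) :
    phaseSq ((y - z₃)⁻¹ - (x - z₃)⁻¹) =
      phaseSq (y - x) / (phaseSq (x - z₃) * phaseSq (y - z₃)) := by
  have : (y - z₃)⁻¹ - (x - z₃)⁻¹ = -((y - x) / ((x - z₃) * (y - z₃))) := by
    field_simp
    ring
  rw [this, phaseSq_neg, phaseSq_div, phaseSq_mul]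

/-- The Ceva identity for the images of `z 0`, `z 1`, `z 2`, `z 4` under the inversion that sends
`z 3` to infinity, written in tangent directions `u j k` of arcs from `z j` to `z k`. Only ratios of
directions at the same point enter: at `z j` with `j ≠ 3` the direction `u j 3` serves as the
reference, and the ratios at `z 3` are the factors `y₀, y₁, y₂`. -/
theorem cevaIdentity_of_tangents {z : Fin 5 → ℂ} (hz : Function.Injective z)
    {u : Fin 5 → Fin 5 → ℂ} (h0 : ∀ i j, i ≠ j → u i j ≠ 0)
    (hu : ∀ i j, i ≠ j → u i j * u j i = -phaseSq (z j - z i)) :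
    CevaIdentity ((u 0 4 / u 0 3) * (u 4 0 / u 4 3)) ((u 1 4 / u 1 3) * (u 4 1 / u 4 3))
      ((u 2 4 / u 2 3) * (u 4 2 / u 4 3)) ((u 0 1 / u 0 3) * (u 1 0 / u 1 3))
      ((u 1 2 / u 1 3) * (u 2 1 / u 2 3)) ((u 0 2 / u 0 3) * (u 2 0 / u 2 3))
      (u 3 4 / u 3 0) (u 3 4 / u 3 1) (u 3 4 / u 3 2) := by
  have hsub : ∀ i j, i ≠ j → z j - z i ≠ 0 := fun i j hij =>
    sub_ne_zero.2 fun e => hij (hz e).symm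
  let w : Fin 5 → ℂ := fun j => (z j - z 3)⁻¹
  have hw : ∀ i j, i ≠ j → w j - w i ≠ 0 := fun i j hij =>
    sub_ne_zero.2 fun e => hij (hz (sub_left_injective (inv_injective e))).symm
  have hphase : ∀ i j, i ≠ j → i ≠ 3 → j ≠ 3 → phaseSq (w j - w i) =
      -(((u i j / u i 3) * (u j i / u j 3)) / (u 3 i * u 3 j)) := by
    intro i j hij hi hj
    have e1 := hu i j hij
    have e2 := hu 3 i hi.symm
    have e3 := hu 3 j hj.symm
    rw [phaseSq_inv_sub_inv (hsub 3 i hi.symm) (hsub 3 j hj.symm), ← neg_eq_iff_eq_neg.2 e1,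
      ← neg_eq_iff_eq_neg.2 e2, ← neg_eq_iff_eq_neg.2 e3]
    have := h0 i 3 hi
    have := h0 j 3 hj
    have := h0 3 i hi.symm
    have := h0 3 j hj.symm
    field_simp
  have ceva := ceva_phaseSq (hw 0 1 (by decide)) (hw 0 2 (by decide)) (hw 1 2 (by decide))
    (hw 0 4 (by decide)) (hw 1 4 (by decide)) (hw 2 4 (by decide))
  rw [hphase 0 1 (by decide) (by decide) (by decide),
    hphase 0 2 (by decide) (by decide) (by decide),
    hphase 1 2 (by decide) (by decide) (by decide), hphase 0 4 (by decide) (by decide) (by decide),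
    hphase 1 4 (by decide) (by decide) (by decide),
    hphase 2 4 (by decide) (by decide) (by decide)] at ceva
  unfold CevaIdentity
  generalize (u 0 4 / u 0 3) * (u 4 0 / u 4 3) = A at *
  generalize (u 1 4 / u 1 3) * (u 4 1 / u 4 3) = B at *
  generalize (u 2 4 / u 2 3) * (u 4 2 / u 4 3) = C at *
  generalize (u 0 1 / u 0 3) * (u 1 0 / u 1 3) = a at *
  generalize (u 1 2 / u 1 3) * (u 2 1 / u 2 3) = b at *
  generalize (u 0 2 / u 0 3) * (u 2 0 / u 2 3) = c at *
  have n0 := h0 3 0 (by decide)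
  have n1 := h0 3 1 (by decide)
  have n2 := h0 3 2 (by decide)
  have n4 := h0 3 4 (by decide)
  generalize u 3 0 = x₀ at *
  generalize u 3 1 = x₁ at *
  generalize u 3 2 = x₂ at *
  generalize u 3 4 = x₄ at *
  field_simp at ceva ⊢
  linear_combination -ceva

/-! ### The contradiction at the vertex of degree six -/

theorem eq_neg_of_pow_four {g g' : ℂ} (h6 : g ^ 6 = 1) (h6' : g' ^ 6 = 1) (h4 : g ^ 4 = g' ^ 4)
    (h : g ≠ g') : g = -g' := by
  have h2 : g ^ 2 = g' ^ 2 := by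
    linear_combination g' ^ 2 * h6 - g ^ 2 * h6' - g ^ 2 * g' ^ 2 * h4
  exact (sq_eq_sq_iff_eq_or_eq_neg.1 h2).resolve_left h

/-- The twelfth roots of unity of the sides are products of fourth roots `p`, `a`, `b`, `c` of
unity and, for the sides at the vertex of degree six, of distinct nontrivial sixth roots `g`. On
fourth powers, a coincidence of two opposite phases forces the sixth root to be `-1`, and an
equality of two products of opposite phases forces two sixth roots to be opposite. Neither can
happen twice. -/
theorem opposite_phases_contradiction {g₀ g₁ g₂ p₀ p₁ p₂ a b c : ℂ}
    (hg₀ : g₀ ^ 6 = 1) (hg₁ : g₁ ^ 6 = 1) (hg₂ : g₂ ^ 6 = 1)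
    (n0 : g₀ ≠ 1) (n1 : g₁ ≠ 1) (n2 : g₂ ≠ 1) (n01 : g₀ ≠ g₁) (n02 : g₀ ≠ g₂) (n12 : g₁ ≠ g₂)
    (hp₀ : p₀ ^ 4 = 1) (hp₁ : p₁ ^ 4 = 1) (hp₂ : p₂ ^ 4 = 1)
    (ha : a ^ 4 = 1) (hb : b ^ 4 = 1) (hc : c ^ 4 = 1)
    (h : (a * (p₂ * g₂) = c * (p₁ * g₁) ∧ c * (p₁ * g₁) = b * (p₀ * g₀)) ∨
      (p₀ * g₀ = b ∧ p₁ * g₁ = c) ∨ (p₁ * g₁ = c ∧ p₂ * g₂ = a) ∨ (p₂ * g₂ = a ∧ p₀ * g₀ = b)) :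
    False := by
  -- fourth powers forget everything but the sixth roots of unity
  have sgl : ∀ {p g x : ℂ}, p ^ 4 = 1 → x ^ 4 = 1 → g ^ 6 = 1 → g ≠ 1 → p * g = x → g = -1 := by
    rintro p g x hp hx hg hg1 rfl
    rw [mul_pow, hp, one_mul] at hx
    exact eq_neg_of_pow_four hg (one_pow 6) (by rw [hx, one_pow]) hg1
  have dbl : ∀ {x p y q : ℂ} {g g' : ℂ}, x ^ 4 = 1 → p ^ 4 = 1 → y ^ 4 = 1 → q ^ 4 = 1 →
      x * (p * g) = y * (q * g') → g ^ 4 = g' ^ 4 := by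
    intro x p y q g g' hx hp hy hq he
    have := congrArg (· ^ 4) he
    simpa [mul_pow, hx, hp, hy, hq] using this
  rcases h with ⟨h1, h2⟩ | ⟨h1, h2⟩ | ⟨h1, h2⟩ | ⟨h1, h2⟩
  · have e1 := eq_neg_of_pow_four hg₂ hg₁ (dbl ha hp₂ hc hp₁ h1) n12.symm
    have e2 := eq_neg_of_pow_four hg₁ hg₀ (dbl hc hp₁ hb hp₀ h2) n01.symm
    exact n02 (by rw [e1, e2, neg_neg])
  · exact n01 ((sgl hp₀ hb hg₀ n0 h1).trans (sgl hp₁ hc hg₁ n1 h2).symm)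
  · exact n12 ((sgl hp₁ hc hg₁ n1 h1).trans (sgl hp₂ ha hg₂ n2 h2).symm)
  · exact n02 ((sgl hp₀ hb hg₀ n0 h2).trans (sgl hp₂ ha hg₂ n2 h1).symm)

/-- Five distinct points cannot be joined pairwise by circular arcs whose start directions `u`
are distinct at each point and differ there by multiples of `2π/4` at three of the points, of
`2π/5` at the fourth and of `2π/6` at the fifth. -/
theorem not_exists_tangents {z : Fin 5 → ℂ} (hz : Function.Injective z)
    {u : Fin 5 → Fin 5 → ℂ} (h0 : ∀ i j, i ≠ j → u i j ≠ 0)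
    (hu : ∀ i j, i ≠ j → u i j * u j i = -phaseSq (z j - z i))
    (hinj : ∀ i j k, i ≠ j → i ≠ k → u i j = u i k → j = k)
    (hd : ∀ i j k, i ≠ j → i ≠ k → (u i j / u i k) ^ (![4, 4, 4, 5, 6] i) = 1) : False := by
  have ceva := cevaIdentity_of_tangents hz h0 hu
  have d4 : ∀ i, i < 3 → ∀ j, i ≠ j → (u i j / u i 3) ^ 4 = 1 := by
    intro i hi j hij
    have := hd i j 3 hij (ne_of_lt hi)
    fin_cases i <;> first | exact this | exact absurd hi (by decide)
  have d5 : ∀ j, 3 ≠ j → (u 3 4 / u 3 j) ^ 5 = 1 := fun j hj => hd 3 4 j (by decide) hj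
  have d6 : ∀ j, 4 ≠ j → (u 4 j / u 4 3) ^ 6 = 1 := fun j hj => hd 4 j 3 hj (by decide)
  have ne1 : ∀ i j k, i ≠ j → i ≠ k → j ≠ k → u i j / u i k ≠ 1 := fun i j k hij hik hjk e =>
    hjk (hinj i j k hij hik ((div_eq_one_iff_eq (h0 i k hik)).1 e))
  have ne3 : ∀ j k, 3 ≠ j → 3 ≠ k → j ≠ k → u 3 4 / u 3 j ≠ u 3 4 / u 3 k :=
    fun j k hj hk hjk e => hjk (hinj 3 j k hj hk
      (inv_injective (mul_left_cancel₀ (h0 3 4 (by decide))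
        (by simpa only [div_eq_mul_inv] using e))))
  have ne4 : ∀ j k, 4 ≠ j → 4 ≠ k → j ≠ k → u 4 j / u 4 3 ≠ u 4 k / u 4 3 :=
    fun j k hj hk hjk e => hjk (hinj 4 j k hj hk ((div_left_inj' (h0 4 3 (by decide))).1 e))
  have prod4 : ∀ {x y : ℂ}, x ^ 4 = 1 → y ^ 4 = 1 → (x * y) ^ 4 = 1 := fun hx hy => by
    rw [mul_pow, hx, hy, one_mul]
  have prod12 : ∀ {x y : ℂ}, x ^ 4 = 1 → y ^ 6 = 1 → (x * y) ^ 12 = 1 := fun {x y} hx hy => by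
    rw [mul_pow, pow_mul x 4 3, pow_mul y 6 2, hx, hy]; norm_num
  have of4 : ∀ {x : ℂ}, x ^ 4 = 1 → x ^ 12 = 1 := fun {x} hx => by
    rw [pow_mul x 4 3, hx, one_pow]
  have p0 := d4 0 (by decide) 4 (by decide)
  have p1 := d4 1 (by decide) 4 (by decide)
  have p2 := d4 2 (by decide) 4 (by decide)
  have ha := prod4 (d4 0 (by decide) 1 (by decide)) (d4 1 (by decide) 0 (by decide))
  have hb := prod4 (d4 1 (by decide) 2 (by decide)) (d4 2 (by decide) 1 (by decide))
  have hc := prod4 (d4 0 (by decide) 2 (by decide)) (d4 2 (by decide) 0 (by decide))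
  have g0 := d6 0 (by decide)
  have g1 := d6 1 (by decide)
  have g2 := d6 2 (by decide)
  refine opposite_phases_contradiction g0 g1 g2
    (ne1 4 0 3 (by decide) (by decide) (by decide)) (ne1 4 1 3 (by decide) (by decide) (by decide))
    (ne1 4 2 3 (by decide) (by decide) (by decide)) (ne4 0 1 (by decide) (by decide) (by decide))
    (ne4 0 2 (by decide) (by decide) (by decide)) (ne4 1 2 (by decide) (by decide) (by decide))
    p0 p1 p2 ha hb hc ?_
  exact ceva.opposite_phases (prod12 p0 g0) (prod12 p1 g1) (prod12 p2 g2) (of4 ha) (of4 hb) (of4 hc)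
    (d5 0 (by decide)) (d5 1 (by decide)) (d5 2 (by decide))
    (ne1 3 4 0 (by decide) (by decide) (by decide)) (ne1 3 4 1 (by decide) (by decide) (by decide))
    (ne1 3 4 2 (by decide) (by decide) (by decide)) (ne3 0 1 (by decide) (by decide) (by decide))
    (ne3 0 2 (by decide) (by decide) (by decide)) (ne3 1 2 (by decide) (by decide) (by decide))

theorem mainTheorem4 : ¬ IsLombardi G8 := by
  rintro ⟨ord, D, hD⟩
  let v : Fin 5 → Fin 8 := Fin.castLE (by norm_num)
  have hv : Function.Injective v := Fin.castLE_injective _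
  have adj : ∀ i j : Fin 5, i ≠ j → G8.Adj (v i) (v j) := by decide
  have deg : ∀ i : Fin 5, G8.degree (v i) = ![4, 4, 4, 5, 6] i := by decide
  let u : Fin 5 → Fin 5 → ℂ := fun i j =>
    if h : i ≠ j then (D.edge (v i) (v j) (adj i j h)).startDir else 0
  have hu : ∀ i j (h : i ≠ j), u i j = (D.edge (v i) (v j) (adj i j h)).startDir :=
    fun i j h => dif_pos h
  refine not_exists_tangents (D.pos_injective.comp hv) (u := u) ?_ ?_ ?_ ?_
  · intro i j h
    rw [hu i j h]
    exact CircArcDrawing.startDir_ne_zero_of_resolution hD _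
  · intro i j h
    rw [hu i j h, hu j i h.symm]
    exact D.startDir_mul_startDir_symm (adj i j h)
  · intro i j k hij hik e
    rw [hu i j hij, hu i k hik] at e
    exact hv (CircArcDrawing.eq_of_startDir_eq hD _ _ e)
  · intro i j k hij hik
    rw [hu i j hij, hu i k hik]
    exact CircArcDrawing.startDir_div_startDir_pow hD (deg i) _ _
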